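/- Let $q\ge 2$ be an integer and let $s_q(n)$ denote the sum of the digits of the standard $q$-ary expansion of the integer $n\ge 0$. There is exactly one continuous $1$-periodic function $\Psi_1:\mathbb R\to\mathbb R$ such that $$\Psi_1(\log_q N)=\frac1N\sum_{0\le n<N}s_q(n)-\frac{q-1}{2}\log_q N$$ for all integers $N\ge 1$. Its Fourier coefficients $c_k=\int_0^1\Psi_1(x)e^{-2\pi i k x}\,dx$, $k\in\mathbb Z$, are $$c_0=\frac{q-1}{2\log q}\bigl(\log(2\pi)-1\bigr)-\frac{q+1}{4},\qquad c_k=-\frac{q-1}{\chi_k(1+\chi_k)\log q}\,\zeta(\chi_k)\quad\text{for } k\neq 0,$$ where $\chi_k=\frac{2\pi i k}{\log q}$ and $\zeta$ denotes the Riemann zeta function. -/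

import Mathlib

/-- The `q`-ary sum-of-digits function `s_q(n)`. -/
def sumOfDigits (q n : ℕ) : ℕ := (Nat.digits q n).sum

/-- `Ψ` is the periodic fluctuation of the `q`-ary sum of digits: a continuous, `1`-periodic
function on the real line whose value at `log_q N` is
`(1/N) ∑_{n<N} s_q(n) - ((q-1)/2) log_q N`, for every positive integer `N`. -/
structure IsDigitFluctuation (q : ℕ) (Ψ : ℝ → ℝ) : Prop where
  continuous : Continuous Ψ
  periodic : Function.Periodic Ψ 1
  value : ∀ N : ℕ, 1 ≤ N →
    Ψ (Real.logb q N) =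
      (1 / (N : ℝ)) * ∑ n ∈ Finset.range N, (sumOfDigits q n : ℝ)
        - (((q : ℝ) - 1) / 2) * Real.logb q N

/-- The points `χ_k = 2πik / log q`. -/
noncomputable def chi (q : ℕ) (k : ℤ) : ℂ :=
  2 * (Real.pi : ℂ) * Complex.I * (k : ℂ) / (Real.log q : ℂ)

/-! Let `G` be the `1`-periodic primitive of the sawtooth `1/2 - {x}`. Summing over `n < N` the
identity `s_q(n) = n - (q - 1) ∑_{j ≥ 1} ⌊n / q ^ j⌋` produces, for each digit position `j`, a
quadratic polynomial in `N` and the oscillation `q ^ j * G(N / q ^ j)`. On the scale `x = log_q N`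
these oscillations form the series `∑_r G(q ^ (x + r)) / q ^ (x + r)`, whose terms vanish once
`q ^ (x + r)` is an integer. Uniqueness holds because the numbers `log_q N` are dense modulo `1`.

Integrating the series against `exp(-2πikx)` over `[0, 1]` unfolds it to a single integral over
`(0, ∞)`, and `v = q ^ y` turns this into the Mellin transform `M(χ_k)` of `G` on `[1, ∞)`. The
Euler–Maclaurin continuation `ζ(s) = 1 / (s - 1) + 1 / 2 + s (s + 1) M(s)`, valid for `re s > -1`,
then gives the coefficients, the one at `k = 0` through `ζ'(0) = -log(2π) / 2`. -/

section Sawtooth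

open Set

/-- The primitive `{x}(1 - {x})/2` of the sawtooth function `1/2 - {x}`, a continuous `1`-periodic
function vanishing at the integers; it is the kernel of the first-order Euler–Maclaurin formula. -/
noncomputable def sawtoothPrimitive (x : ℝ) : ℝ := Int.fract x * (1 - Int.fract x) / 2

theorem continuous_sawtoothPrimitive : Continuous sawtoothPrimitive :=
  ContinuousOn.comp_fract'' (f := fun x : ℝ ↦ x * (1 - x) / 2) (by fun_prop) (by norm_num)

@[simp]
theorem sawtoothPrimitive_natCast (n : ℕ) : sawtoothPrimitive n = 0 := by
  simp [sawtoothPrimitive]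

theorem abs_sawtoothPrimitive_le_one (x : ℝ) : |sawtoothPrimitive x| ≤ 1 := by
  have h₀ := Int.fract_nonneg x
  have h₁ := Int.fract_lt_one x
  rw [sawtoothPrimitive, abs_le]
  constructor <;> nlinarith

theorem hasDerivWithinAt_sawtoothPrimitive (x : ℝ) :
    HasDerivWithinAt sawtoothPrimitive (1 / 2 - Int.fract x) (Ioi x) x := by
  have hsub : HasDerivAt (fun v : ℝ ↦ v - ⌊x⌋) 1 x := (hasDerivAt_id x).sub_const _
  have hpoly : HasDerivAt (fun v : ℝ ↦ (v - ⌊x⌋) * (1 - (v - ⌊x⌋)) / 2) (1 / 2 - Int.fract x) x :=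
    ((hsub.mul (hsub.const_sub 1)).div_const 2).congr_deriv (by rw [← Int.self_sub_floor]; ring)
  refine hpoly.hasDerivWithinAt.congr_of_eventuallyEq ?_ rfl
  filter_upwards [Ioo_mem_nhdsGT (Int.lt_floor_add_one x)] with v hv
  have hfloor : ⌊v⌋ = ⌊x⌋ := Int.floor_eq_iff.2 ⟨(Int.floor_le x).trans hv.1.le, hv.2⟩
  rw [sawtoothPrimitive, Int.fract, hfloor]

end Sawtooth

section DigitSums

open Finset

theorem sum_range_mul_add_div {m b : ℕ} (hb : b ≤ m) (a : ℕ) :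
    ∑ n ∈ range (m * a + b), n / m = m * a.choose 2 + a * b := by
  have hblock : ∀ a b, b ≤ m → ∑ i ∈ range b, (m * a + i) / m = a * b := by
    intro a b hb
    rw [sum_congr rfl fun i hi ↦ show (m * a + i) / m = a from ?_, sum_const, card_range,
      smul_eq_mul, mul_comm]
    have him : i < m := (mem_range.1 hi).trans_le hb
    rw [Nat.mul_add_div (by omega), Nat.div_eq_of_lt him, add_zero]
  have hfull : ∑ n ∈ range (m * a), n / m = m * a.choose 2 := by
    induction a with
    | zero => simp
    | succ a ih =>
      rw [mul_add_one, sum_range_add, ih, hblock a m le_rfl, Nat.choose_succ_succ' a 1,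
        Nat.choose_one_right]
      ring
  rw [sum_range_add, hfull, hblock a b hb]

theorem sum_range_div_eq_sawtoothPrimitive {m : ℕ} (hm : 0 < m) (N : ℕ) :
    ∑ n ∈ range N, ((n / m : ℕ) : ℝ) =
      (N : ℝ) ^ 2 / (2 * m) - N / 2 + m * sawtoothPrimitive (N / m) := by
  have hsum := sum_range_mul_add_div (Nat.mod_lt N hm).le (N / m)
  rw [Nat.div_add_mod] at hsum
  have hN : (N : ℝ) = m * (N / m : ℕ) + (N % m : ℕ) := mod_cast (Nat.div_add_mod N m).symm
  have hm' : (m : ℝ) ≠ 0 := mod_cast hm.ne'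
  rw [← Nat.cast_sum, hsum, sawtoothPrimitive, Int.fract_div_natCast_eq_div_natCast_mod]
  push_cast [Nat.cast_choose_two]
  rw [hN]
  field_simp
  ring

theorem sumOfDigits_eq_mod_add_sumOfDigits_div {q : ℕ} (hq : 2 ≤ q) (n : ℕ) :
    sumOfDigits q n = n % q + sumOfDigits q (n / q) := by
  rcases n.eq_zero_or_pos with rfl | hn
  · simp [sumOfDigits]
  · rw [sumOfDigits, Nat.digits_def' hq hn, List.sum_cons, sumOfDigits]

theorem sumOfDigits_add_mul_sum_div_pow {q : ℕ} (hq : 2 ≤ q) {L n : ℕ} (hn : n < q ^ (L + 1)) :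
    sumOfDigits q n + (q - 1) * ∑ j ∈ range L, n / q ^ (j + 1) = n := by
  induction L generalizing n with
  | zero =>
    rw [zero_add, pow_one] at hn
    rw [range_zero, sum_empty, mul_zero, add_zero, sumOfDigits_eq_mod_add_sumOfDigits_div hq,
      Nat.mod_eq_of_lt hn, Nat.div_eq_of_lt hn]
    simp [sumOfDigits]
  | succ L ih =>
    have hdiv : ∀ j, n / q ^ (j + 1 + 1) = n / q / q ^ (j + 1) := fun j ↦ by
      rw [Nat.div_div_eq_div_mul, ← pow_succ']
    have ih' := ih (n := n / q) (Nat.div_lt_of_lt_mul (by rwa [← pow_succ']))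
    rw [sum_range_succ', sumOfDigits_eq_mod_add_sumOfDigits_div hq n]
    simp only [hdiv, zero_add, pow_one]
    obtain ⟨p, rfl⟩ : ∃ p, q = p + 1 := ⟨q - 1, by omega⟩
    rw [Nat.add_sub_cancel] at ih' ⊢
    linarith [Nat.div_add_mod n (p + 1)]

end DigitSums

section Profile

open Set

variable {b : ℝ}

/-- The oscillation `G(b ^ y) / b ^ y`, where `G` is the primitive of the sawtooth: the contribution
of one digit position to the fluctuation in base `b`, on the logarithmic scale. -/
noncomputable def dampedSawtooth (b y : ℝ) : ℝ := sawtoothPrimitive (b ^ y) / b ^ y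

theorem norm_dampedSawtooth_le (hb : 0 < b) (y : ℝ) : ‖dampedSawtooth b y‖ ≤ b ^ (-y) := by
  rw [dampedSawtooth, norm_div, Real.rpow_neg hb.le, ← one_div, Real.norm_eq_abs,
    Real.norm_of_nonneg (by positivity : 0 ≤ b ^ y)]
  gcongr
  exact abs_sawtoothPrimitive_le_one _

theorem continuous_dampedSawtooth (hb : 0 < b) : Continuous (dampedSawtooth b) := by
  have hpow : Continuous fun y : ℝ ↦ b ^ y := Real.continuous_const_rpow hb.ne'
  exact (continuous_sawtoothPrimitive.comp hpow).div hpow fun y ↦ (by positivity)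

theorem dampedSawtooth_eq_zero {y : ℝ} {n : ℕ} (h : b ^ y = n) : dampedSawtooth b y = 0 := by
  rw [dampedSawtooth, h, sawtoothPrimitive_natCast, zero_div]

/-- The superposition `∑ r, G(b ^ (x + r)) / b ^ (x + r)` over `r ≥ 0` of the damped sawtooths. -/
noncomputable def dampedSawtoothSeries (b x : ℝ) : ℝ := ∑' r : ℕ, dampedSawtooth b (x + r)

theorem norm_dampedSawtooth_add_natCast_le (hb : 1 < b) {a x : ℝ} (hx : a ≤ x) (r : ℕ) :
    ‖dampedSawtooth b (x + r)‖ ≤ b ^ (-a) * b⁻¹ ^ r := by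
  have hb₀ : 0 < b := one_pos.trans hb
  calc ‖dampedSawtooth b (x + r)‖ ≤ b ^ (-(x + r)) := norm_dampedSawtooth_le hb₀ _
    _ = b ^ (-x) * b⁻¹ ^ r := by
      rw [neg_add, Real.rpow_add hb₀, Real.rpow_neg hb₀.le r, Real.rpow_natCast, inv_pow]
    _ ≤ b ^ (-a) * b⁻¹ ^ r := by gcongr; exact hb.le

theorem summable_const_mul_inv_pow (hb : 1 < b) (c : ℝ) : Summable fun r : ℕ ↦ c * b⁻¹ ^ r :=
  (summable_geometric_of_lt_one (by positivity) (inv_lt_one_of_one_lt₀ hb)).mul_left c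

theorem summable_dampedSawtooth (hb : 1 < b) (x : ℝ) :
    Summable fun r : ℕ ↦ dampedSawtooth b (x + r) :=
  .of_norm_bounded (summable_const_mul_inv_pow hb _)
    (norm_dampedSawtooth_add_natCast_le hb (le_refl x))

theorem continuous_dampedSawtoothSeries (hb : 1 < b) : Continuous (dampedSawtoothSeries b) := by
  have hterm (r : ℕ) : Continuous fun x : ℝ ↦ dampedSawtooth b (x + r) :=
    (continuous_dampedSawtooth (one_pos.trans hb)).comp (by fun_prop)
  have hIci (a : ℝ) : ContinuousOn (dampedSawtoothSeries b) (Ici a) :=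
    continuousOn_tsum (fun r ↦ (hterm r).continuousOn) (summable_const_mul_inv_pow hb _)
      fun r _ hx ↦ norm_dampedSawtooth_add_natCast_le hb hx r
  exact continuous_iff_continuousAt.2 fun x ↦
    (hIci (x - 1)).continuousAt (Ici_mem_nhds (sub_one_lt x))

theorem dampedSawtoothSeries_eq_add (hb : 1 < b) (x : ℝ) :
    dampedSawtoothSeries b x = dampedSawtooth b x + dampedSawtoothSeries b (x + 1) := by
  rw [dampedSawtoothSeries, (summable_dampedSawtooth hb x).tsum_eq_zero_add, dampedSawtoothSeries]
  simp only [Nat.cast_zero, add_zero, Nat.cast_succ, add_comm (1 : ℝ), add_assoc]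

/-- The fluctuation of the sum of digits in base `b` on one period `[0, 1]`: half the deviation of
`b ^ x` from its chord, corrected by the damped sawtooths. The base is an arbitrary real number. -/
noncomputable def delangeProfile (b x : ℝ) : ℝ :=
  (b ^ x - 1 - (b - 1) * x) / 2 - (b - 1) * dampedSawtoothSeries b x

theorem continuous_delangeProfile (hb : 1 < b) : Continuous (delangeProfile b) := by
  have hpow : Continuous fun y : ℝ ↦ b ^ y := Real.continuous_const_rpow (one_pos.trans hb).ne'
  have hseries := continuous_dampedSawtoothSeries hb
  unfold delangeProfile
  fun_prop

theorem delangeProfile_eq_add_one (hb : 1 < b) (x : ℝ) :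
    delangeProfile b x =
      delangeProfile b (x + 1) + (b - 1) * ((1 - b ^ x) / 2 - dampedSawtooth b x) := by
  rw [delangeProfile, delangeProfile, dampedSawtoothSeries_eq_add hb x,
    Real.rpow_add_one (one_pos.trans hb).ne']
  ring

theorem delangeProfile_zero_eq_one (hb : 1 < b) : delangeProfile b 0 = delangeProfile b 1 := by
  have h := delangeProfile_eq_add_one hb 0
  rw [dampedSawtooth_eq_zero (n := 1) (by simp)] at h
  simpa using h

/-- The `1`-periodic extension of the profile. -/
noncomputable def delangeFluctuation (b x : ℝ) : ℝ := delangeProfile b (Int.fract x)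

theorem continuous_delangeFluctuation (hb : 1 < b) : Continuous (delangeFluctuation b) :=
  (continuous_delangeProfile hb).continuousOn.comp_fract'' (delangeProfile_zero_eq_one hb)

theorem periodic_delangeFluctuation (b : ℝ) : Function.Periodic (delangeFluctuation b) 1 :=
  fun x ↦ by rw [delangeFluctuation, Int.fract_add_one, delangeFluctuation]

theorem delangeFluctuation_eq_delangeProfile (hb : 1 < b) {x : ℝ} (hx : x ∈ Icc (0 : ℝ) 1) :
    delangeFluctuation b x = delangeProfile b x := by
  rcases hx.2.lt_or_eq with hx₁ | rfl
  · rw [delangeFluctuation, Int.fract_eq_self.2 ⟨hx.1, hx₁⟩]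
  · rw [delangeFluctuation, Int.fract_one, delangeProfile_zero_eq_one hb]

end Profile

section Values

open Finset

variable {q N : ℕ}

theorem dampedSawtoothSeries_logb_natCast (hq : 2 ≤ q) (hN : 0 < N) :
    dampedSawtoothSeries q (Real.logb q N) = 0 := by
  have hq₀ : (0 : ℝ) < q := by positivity
  have hq₁ : (q : ℝ) ≠ 1 := by norm_cast; omega
  have hterm (r : ℕ) : dampedSawtooth q (Real.logb q N + r) = 0 :=
    dampedSawtooth_eq_zero (n := N * q ^ r) (by
      rw [Real.rpow_add hq₀, Real.rpow_logb hq₀ hq₁ (by positivity), Real.rpow_natCast]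
      push_cast
      rfl)
  simp only [dampedSawtoothSeries, hterm, tsum_zero]

-- Raising `L` by one subtracts `(q - 1) * ∑ ⌊n / q ^ (L + 1)⌋` on the left, which is the increment
-- of the profile between `log_q N - L` and `log_q N - (L + 1)`.
theorem sum_sub_mul_sum_div_pow_eq_delangeProfile (hq : 2 ≤ q) (hN : 0 < N) (L : ℕ) :
    ∑ n ∈ range N, ((n : ℝ) - (q - 1) * ∑ j ∈ range L, ((n / q ^ (j + 1) : ℕ) : ℝ)) =
      N * (delangeProfile q (Real.logb q N - L) + (q - 1) / 2 * Real.logb q N) := by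
  have hq₀ : (0 : ℝ) < q := by positivity
  have hq₁ : (1 : ℝ) < q := by norm_cast
  have hpow : (q : ℝ) ^ Real.logb q N = N := Real.rpow_logb hq₀ hq₁.ne' (by positivity)
  induction L with
  | zero =>
    have hgauss : ∑ n ∈ range N, (n : ℝ) = (N : ℝ) ^ 2 / 2 - N / 2 := by
      simpa using sum_range_div_eq_sawtoothPrimitive one_pos N
    simp only [range_zero, sum_empty, mul_zero, sub_zero, Nat.cast_zero, delangeProfile, hgauss,
      dampedSawtoothSeries_logb_natCast hq hN, hpow]
    ring
  | succ L ih =>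
    have hpowL : (q : ℝ) ^ (Real.logb q N - (L + 1 : ℕ)) = N / q ^ (L + 1) := by
      rw [Real.rpow_sub hq₀, hpow, Real.rpow_natCast]
    have hstep := delangeProfile_eq_add_one hq₁ (Real.logb q N - (L + 1 : ℕ))
    rw [dampedSawtooth, hpowL, show Real.logb q N - (L + 1 : ℕ) + 1 = Real.logb q N - L by
      push_cast; ring] at hstep
    have hdiv := sum_range_div_eq_sawtoothPrimitive (pow_pos (by omega : 0 < q) (L + 1)) N
    push_cast at hdiv
    simp only [sum_range_succ _ L, mul_add, ← sub_sub]
    rw [sum_sub_distrib, ih, ← mul_sum, hdiv, hstep]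
    field_simp
    ring

theorem sum_sumOfDigits_eq_delangeProfile (hq : 2 ≤ q) (hN : 0 < N) {L : ℕ}
    (hL : N ≤ q ^ (L + 1)) :
    ∑ n ∈ range N, (sumOfDigits q n : ℝ) =
      N * (delangeProfile q (Real.logb q N - L) + (q - 1) / 2 * Real.logb q N) := by
  rw [← sum_sub_mul_sum_div_pow_eq_delangeProfile hq hN]
  refine sum_congr rfl fun n hn ↦ eq_sub_of_add_eq ?_
  rw [← Nat.cast_pred (by omega)]
  exact_mod_cast sumOfDigits_add_mul_sum_div_pow hq ((mem_range.1 hn).trans_le hL)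

theorem isDigitFluctuation_delangeFluctuation (hq : 2 ≤ q) :
    IsDigitFluctuation q (delangeFluctuation q) where
  continuous := continuous_delangeFluctuation (by norm_cast)
  periodic := periodic_delangeFluctuation q
  value N hN := by
    have hfract : Int.fract (Real.logb q N) = Real.logb q N - Nat.log q N := by
      rw [Int.fract, Real.floor_logb_natCast N.cast_nonneg, Int.log_natCast, Int.cast_natCast]
    rw [sum_sumOfDigits_eq_delangeProfile hq hN (Nat.lt_pow_succ_log_self hq N).le,
      delangeFluctuation, hfract, one_div_mul_eq_div, mul_div_cancel_left₀ _ (by positivity),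
      add_sub_cancel_right]

end Values

section Uniqueness

open Filter Topology

variable {b : ℝ}

theorem tendsto_logb_floor_rpow_sub (hb : 1 < b) (x : ℝ) :
    Tendsto (fun m : ℕ ↦ Real.logb b ⌊b ^ (x + m)⌋₊ - m) atTop (𝓝 x) := by
  have hb₀ : 0 < b := one_pos.trans hb
  have hpow : Tendsto (fun m : ℕ ↦ b ^ (x + m)) atTop atTop :=
    (tendsto_rpow_atTop_of_base_gt_one _ hb).comp
      (tendsto_atTop_add_const_left _ _ tendsto_natCast_atTop_atTop)
  have hlog : Tendsto (fun m : ℕ ↦ Real.logb b (⌊b ^ (x + m)⌋₊ / b ^ (x + m))) atTop (𝓝 0) := by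
    rw [← Real.logb_one (b := b)]
    exact (Real.continuousAt_logb one_ne_zero).tendsto.comp (tendsto_nat_floor_div_atTop.comp hpow)
  have hlim : Tendsto (fun m : ℕ ↦ x + Real.logb b (⌊b ^ (x + m)⌋₊ / b ^ (x + m))) atTop (𝓝 x) := by
    simpa using hlog.const_add x
  refine hlim.congr' ?_
  filter_upwards [hpow.eventually_ge_atTop 1] with m hm
  have hfloor : (⌊b ^ (x + m)⌋₊ : ℝ) ≠ 0 := mod_cast (Nat.floor_pos.2 hm).ne'
  rw [Real.logb_div hfloor (by positivity), Real.logb_rpow hb₀ hb.ne']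
  ring

theorem eq_of_periodic_of_forall_logb_natCast_eq (hb : 1 < b) {E : Type*} [TopologicalSpace E]
    [T2Space E] {f g : ℝ → E} (hf : Continuous f) (hg : Continuous g)
    (hf₁ : Function.Periodic f 1) (hg₁ : Function.Periodic g 1)
    (h : ∀ N : ℕ, 1 ≤ N → f (Real.logb b N) = g (Real.logb b N)) : f = g := by
  funext x
  have hf_sub (y : ℝ) (m : ℕ) : f (y - m) = f y := by simpa using hf₁.sub_nat_mul_eq m
  have hg_sub (y : ℝ) (m : ℕ) : g (y - m) = g y := by simpa using hg₁.sub_nat_mul_eq m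
  have hlim := tendsto_logb_floor_rpow_sub hb x
  refine tendsto_nhds_unique ((hf.tendsto x).comp hlim) (((hg.tendsto x).comp hlim).congr' ?_)
  filter_upwards [eventually_ge_atTop ⌈-x⌉₊] with m hm
  have hN : 1 ≤ ⌊b ^ (x + m)⌋₊ := Nat.le_floor (mod_cast
    Real.one_le_rpow hb.le (neg_le_iff_add_nonneg'.1 (Nat.ceil_le.1 hm)))
  rw [Function.comp_apply, Function.comp_apply, hf_sub, hg_sub, h _ hN]

theorem IsDigitFluctuation.eq_delangeFluctuation {q : ℕ} (hq : 2 ≤ q) {Ψ : ℝ → ℝ}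
    (hΨ : IsDigitFluctuation q Ψ) : Ψ = delangeFluctuation q := by
  have hΦ := isDigitFluctuation_delangeFluctuation hq
  exact eq_of_periodic_of_forall_logb_natCast_eq (b := q) (by norm_cast) hΨ.continuous hΦ.continuous
    hΨ.periodic hΦ.periodic fun N hN ↦ (hΨ.value N hN).trans (hΦ.value N hN).symm

end Uniqueness

section ImproperIntegral

open Set Filter Topology MeasureTheory

theorem integral_Ioi_of_hasDerivWithinAt_Ioi_of_tendsto {E : Type*} [NormedAddCommGroup E]
    [NormedSpace ℝ E] [CompleteSpace E] {f f' : ℝ → E} {a : ℝ} {m : E}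
    (hcont : ContinuousOn f (Ici a)) (hderiv : ∀ x ∈ Ioi a, HasDerivWithinAt f (f' x) (Ioi x) x)
    (f'int : IntegrableOn f' (Ioi a)) (hf : Tendsto f atTop (𝓝 m)) :
    ∫ x in Ioi a, f' x = m - f a := by
  refine tendsto_nhds_unique (intervalIntegral_tendsto_integral_Ioi a f'int tendsto_id)
    ((hf.sub_const (f a)).congr' ?_)
  filter_upwards [eventually_ge_atTop a] with x hx
  refine (intervalIntegral.integral_eq_sub_of_hasDeriv_right_of_le hx
    (hcont.mono Icc_subset_Ici_self) (fun y hy ↦ hderiv y hy.1) ?_).symm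
  exact (intervalIntegrable_iff_integrableOn_Ioc_of_le hx).2 (f'int.mono_set Ioc_subset_Ioi_self)

theorem integrableOn_Ioi_cpow_mul_of_bounded {f : ℝ → ℂ} (hf : AEStronglyMeasurable f) {C : ℝ}
    (hC : ∀ v, ‖f v‖ ≤ C) {a : ℂ} (ha : a.re < -1) {c : ℝ} (hc : 0 < c) :
    IntegrableOn (fun v : ℝ ↦ (v : ℂ) ^ a * f v) (Ioi c) :=
  (integrableOn_Ioi_cpow_of_lt ha hc).mul_bdd hf.restrict (.of_forall hC)

theorem mellin_indicator_Ioi {E : Type*} [NormedAddCommGroup E] [NormedSpace ℂ E] (f : ℝ → E)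
    {c : ℝ} (hc : 0 ≤ c) (s : ℂ) :
    mellin ((Ioi c).indicator f) s = ∫ v in Ioi c, (v : ℂ) ^ (s - 1) • f v := by
  have hsmul : (fun v : ℝ ↦ (v : ℂ) ^ (s - 1) • (Ioi c).indicator f v) =
      (Ioi c).indicator fun v : ℝ ↦ (v : ℂ) ^ (s - 1) • f v := (indicator_smul _ _ _).symm
  rw [mellin, hsmul, setIntegral_indicator measurableSet_Ioi,
    inter_eq_self_of_subset_right (Ioi_subset_Ioi hc)]

theorem differentiableAt_mellin_indicator_Ioi {E : Type*} [NormedAddCommGroup E] [NormedSpace ℂ E]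
    {f : ℝ → E} (hf : LocallyIntegrable f) {C : ℝ} (hC : ∀ v, ‖f v‖ ≤ C) {c : ℝ} (hc : 0 < c)
    {s : ℂ} (hs : s.re < 0) : DifferentiableAt ℂ (mellin ((Ioi c).indicator f)) s := by
  refine mellin_differentiableAt_of_isBigO_rpow (a := 0) (b := s.re - 1)
    ((hf.indicator measurableSet_Ioi).locallyIntegrableOn _) ?_ hs ?_ (sub_one_lt _)
  · refine Asymptotics.IsBigO.of_bound C (.of_forall fun v ↦ ?_)
    simpa using (norm_indicator_le_norm_self _ _).trans (hC v)
  · refine (Asymptotics.isBigO_zero _ _).congr' ?_ .rfl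
    filter_upwards [Ioo_mem_nhdsGT hc] with v hv
    exact (indicator_of_notMem (notMem_Ioi.2 hv.2.le) _).symm

end ImproperIntegral

section Mellin

open Set Filter Topology MeasureTheory

variable {s : ℂ}

/-- The Mellin transform `∫_1^∞ G(v) v ^ (-2 - s) dv` of the primitive `G` of the sawtooth, which
converges for `-1 < re s`. -/
noncomputable def sawtoothMellin (s : ℂ) : ℂ :=
  ∫ v in Ioi (1 : ℝ), (v : ℂ) ^ (-2 - s) * (sawtoothPrimitive v : ℂ)

theorem norm_ofReal_sawtoothPrimitive_le_one (v : ℝ) : ‖(sawtoothPrimitive v : ℂ)‖ ≤ 1 := by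
  simpa using abs_sawtoothPrimitive_le_one v

theorem continuous_ofReal_sawtoothPrimitive : Continuous fun v ↦ (sawtoothPrimitive v : ℂ) :=
  Complex.continuous_ofReal.comp continuous_sawtoothPrimitive

theorem integrableOn_cpow_mul_sawtoothPrimitive (hs : -1 < s.re) :
    IntegrableOn (fun v : ℝ ↦ (v : ℂ) ^ (-2 - s) * (sawtoothPrimitive v : ℂ)) (Ioi 1) :=
  integrableOn_Ioi_cpow_mul_of_bounded continuous_ofReal_sawtoothPrimitive.aestronglyMeasurable
    norm_ofReal_sawtoothPrimitive_le_one
    (by rw [Complex.sub_re, Complex.neg_re, Complex.re_ofNat]; linarith) one_pos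

theorem integrableOn_cpow_mul_half_sub_fract (hs : 0 < s.re) :
    IntegrableOn (fun v : ℝ ↦ (v : ℂ) ^ (-1 - s) * ((1 / 2 - Int.fract v : ℝ) : ℂ)) (Ioi 1) := by
  refine integrableOn_Ioi_cpow_mul_of_bounded (C := 1) (Measurable.aestronglyMeasurable
    (by fun_prop)) (fun v ↦ ?_) (by simpa using hs) one_pos
  rw [Complex.norm_real, Real.norm_eq_abs, abs_le]
  constructor <;> linarith [Int.fract_nonneg v, Int.fract_lt_one v]

theorem tendsto_cpow_mul_sawtoothPrimitive (hs : 0 < s.re) :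
    Tendsto (fun v : ℝ ↦ (v : ℂ) ^ (-s) * (sawtoothPrimitive v : ℂ)) atTop (𝓝 0) := by
  refine squeeze_zero_norm' ?_ (tendsto_rpow_neg_atTop hs)
  filter_upwards [eventually_gt_atTop 0] with v hv
  rw [norm_mul, Complex.norm_cpow_eq_rpow_re_of_pos hv, Complex.neg_re]
  exact mul_le_of_le_one_right (by positivity) (norm_ofReal_sawtoothPrimitive_le_one v)

theorem one_add_mul_sawtoothMellin (hs : 0 < s.re) :
    (1 + s) * sawtoothMellin s =
      ∫ v in Ioi (1 : ℝ), (v : ℂ) ^ (-1 - s) * ((1 / 2 - Int.fract v : ℝ) : ℂ) := by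
  have hM := (integrableOn_cpow_mul_sawtoothPrimitive (s := s) (by linarith)).const_mul (-1 - s)
  have hD := integrableOn_cpow_mul_half_sub_fract hs
  have hre : (-1 - s).re = -1 - s.re := by simp
  have hne : -1 - s ≠ 0 := fun h ↦ by
    rw [h, Complex.zero_re] at hre
    linarith
  have hcont : ContinuousOn (fun v : ℝ ↦ (v : ℂ) ^ (-1 - s) * (sawtoothPrimitive v : ℂ))
      (Ici 1) := fun v (hv : 1 ≤ v) ↦ ((Complex.continuousAt_ofReal_cpow_const _ _
    (.inr (by positivity))).mul continuous_ofReal_sawtoothPrimitive.continuousAt).continuousWithinAt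
  have hderiv (v : ℝ) (hv : v ∈ Ioi (1 : ℝ)) :
      HasDerivWithinAt (fun v : ℝ ↦ (v : ℂ) ^ (-1 - s) * (sawtoothPrimitive v : ℂ))
        ((-1 - s) * ((v : ℂ) ^ (-2 - s) * (sawtoothPrimitive v : ℂ)) +
          (v : ℂ) ^ (-1 - s) * ((1 / 2 - Int.fract v : ℝ) : ℂ)) (Ioi v) v := by
    have hpow := hasDerivAt_ofReal_cpow_const (one_pos.trans hv).ne' hne
    refine (hpow.hasDerivWithinAt.mul
      (hasDerivWithinAt_sawtoothPrimitive v).ofReal_comp).congr_deriv ?_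
    rw [show -1 - s - 1 = -2 - s by ring, mul_assoc]
  have hlim : Tendsto (fun v : ℝ ↦ (v : ℂ) ^ (-1 - s) * (sawtoothPrimitive v : ℂ)) atTop (𝓝 0) := by
    rw [show -1 - s = -(1 + s) by ring]
    exact tendsto_cpow_mul_sawtoothPrimitive (by rw [Complex.add_re, Complex.one_re]; linarith)
  have hG : sawtoothPrimitive 1 = 0 := mod_cast sawtoothPrimitive_natCast 1
  have hparts := integral_Ioi_of_hasDerivWithinAt_Ioi_of_tendsto hcont hderiv (hM.add hD) hlim
  rw [integral_add hM hD, integral_const_mul, ← sawtoothMellin, hG, Complex.ofReal_zero,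
    mul_zero] at hparts
  linear_combination -hparts

theorem riemannZeta_eq_mul_integral_floor (hs : 1 < s.re) :
    riemannZeta s = s * ∫ t in Ioi (1 : ℝ), (⌊t⌋₊ : ℂ) * (t : ℂ) ^ (-(s + 1)) := by
  rw [← LSeries_one_eq_riemannZeta hs, Pi.one_def]
  simpa using LSeries_eq_mul_integral' (fun _ ↦ (1 : ℂ)) zero_le_one hs
    (by simpa using Asymptotics.isBigO_refl (fun n : ℕ ↦ (n : ℝ)) atTop)

theorem natFloor_mul_cpow_eq {v : ℝ} (hv : 0 < v) (s : ℂ) :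
    (⌊v⌋₊ : ℂ) * (v : ℂ) ^ (-(s + 1)) =
      (v : ℂ) ^ (-1 - s) * ((1 / 2 - Int.fract v : ℝ) : ℂ) +
        ((v : ℂ) ^ (-s) - 1 / 2 * (v : ℂ) ^ (-1 - s)) := by
  have hfloor : (⌊v⌋₊ : ℝ) = v - Int.fract v := by
    rw [natCast_floor_eq_intCast_floor hv.le, Int.self_sub_fract]
  have hpow : (v : ℂ) ^ (-s) = v * (v : ℂ) ^ (-1 - s) := by
    rw [show -s = 1 + (-1 - s) by ring, Complex.cpow_add _ _ (mod_cast hv.ne'), Complex.cpow_one]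
  rw [← Complex.ofReal_natCast, hfloor, hpow, show -(s + 1) = -1 - s by ring]
  push_cast
  ring

theorem riemannZeta_eq_sawtoothMellin_of_one_lt_re (hs : 1 < s.re) :
    riemannZeta s = (s - 1)⁻¹ + (1 / 2 + s * (s + 1) * sawtoothMellin s) := by
  have hs₀ : s ≠ 0 := by rintro rfl; rw [Complex.zero_re] at hs; linarith
  have hs₁ : s - 1 ≠ 0 := fun h ↦ by simp [sub_eq_zero.1 h] at hs
  have hA : (-1 - s).re < -1 := by
    rw [Complex.sub_re, Complex.neg_re, Complex.one_re]
    linarith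
  have hB : (-s).re < -1 := by simpa using hs
  have hIA := (integrableOn_Ioi_cpow_of_lt hA one_pos).const_mul (1 / 2)
  have hIB := integrableOn_Ioi_cpow_of_lt hB one_pos
  have hIBA : IntegrableOn (fun v : ℝ ↦ (v : ℂ) ^ (-s) - 1 / 2 * (v : ℂ) ^ (-1 - s)) (Ioi 1) :=
    hIB.sub hIA
  have hID := integrableOn_cpow_mul_half_sub_fract (s := s) (by linarith)
  rw [riemannZeta_eq_mul_integral_floor hs,
    setIntegral_congr_fun measurableSet_Ioi fun v hv ↦ natFloor_mul_cpow_eq (one_pos.trans hv) s,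
    integral_add hID hIBA, integral_sub hIB hIA, integral_const_mul,
    ← one_add_mul_sawtoothMellin (by linarith), integral_Ioi_cpow_of_lt hA one_pos,
    integral_Ioi_cpow_of_lt hB one_pos, show -1 - s + 1 = -s by ring,
    show -s + 1 = -(s - 1) by ring, Complex.ofReal_one, Complex.one_cpow, Complex.one_cpow]
  field_simp
  ring

theorem differentiableAt_sawtoothMellin (hs : -1 < s.re) :
    DifferentiableAt ℂ sawtoothMellin s := by
  have hmellin : sawtoothMellin = fun s ↦
      mellin ((Ioi 1).indicator fun v ↦ (sawtoothPrimitive v : ℂ)) (-1 - s) := by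
    funext s
    rw [mellin_indicator_Ioi _ zero_le_one, show -1 - s - 1 = -2 - s by ring]
    rfl
  rw [hmellin]
  exact (differentiableAt_mellin_indicator_Ioi
    continuous_ofReal_sawtoothPrimitive.locallyIntegrable norm_ofReal_sawtoothPrimitive_le_one
    one_pos (by rw [Complex.sub_re, Complex.neg_re, Complex.one_re]; linarith)).comp s (by fun_prop)

theorem riemannZeta₀_eq_sawtoothMellin (hs : -1 < s.re) :
    riemannZeta₀ s = 1 / 2 + s * (s + 1) * sawtoothMellin s := by
  have hU : IsOpen {s : ℂ | -1 < s.re} := isOpen_lt continuous_const Complex.continuous_re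
  have hζ : AnalyticOnNhd ℂ riemannZeta₀ {s : ℂ | -1 < s.re} :=
    differentiable_riemannZeta₀.differentiableOn.analyticOnNhd hU
  have hM : AnalyticOnNhd ℂ (fun s ↦ 1 / 2 + s * (s + 1) * sawtoothMellin s)
      {s : ℂ | -1 < s.re} := by
    refine DifferentiableOn.analyticOnNhd (fun s hs ↦ ?_) hU
    have := differentiableAt_sawtoothMellin hs
    exact DifferentiableAt.differentiableWithinAt (by fun_prop)
  refine hζ.eqOn_of_preconnected_of_eventuallyEq hM (z₀ := 2)
    (convex_halfSpace_re_gt (-1)).isPreconnected (by norm_num [mem_ofPred_eq]) ?_ hs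
  filter_upwards [(isOpen_lt continuous_const Complex.continuous_re).mem_nhds
    (show (2 : ℂ) ∈ {s : ℂ | 1 < s.re} by simp)] with s hs
  have hs₁ : s ≠ 1 := by rintro rfl; simp at hs
  exact add_left_cancel <| (riemannZeta_eq_inv_sub_add hs₁).symm.trans
    (riemannZeta_eq_sawtoothMellin_of_one_lt_re hs)

theorem sawtoothMellin_zero :
    sawtoothMellin 0 = ((1 - Real.log (2 * Real.pi) / 2 : ℝ) : ℂ) := by
  have hM := (differentiableAt_sawtoothMellin (s := 0) (by simp)).hasDerivAt
  have hid := hasDerivAt_id (0 : ℂ)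
  have hright := ((hid.mul (hid.add_const 1)).mul hM).const_add (1 / 2)
  have hζ := (differentiableAt_riemannZeta zero_ne_one).hasDerivAt
  have hleft := hζ.sub ((hid.sub_const 1).inv (by simp))
  have heq := hright.unique (hleft.congr_of_eventuallyEq ?_)
  · have hlog : Complex.log (2 * Real.pi) = Real.log (2 * Real.pi) := by
      rw [Complex.ofReal_log (by positivity)]
      push_cast
      rfl
    rw [deriv_riemannZeta_zero, hlog] at heq
    simp only [id_eq, zero_add, mul_one, add_zero, one_mul, Pi.mul_apply, zero_mul, zero_sub,
      neg_sq, one_pow, div_one, sub_neg_eq_add] at heq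
    push_cast
    linear_combination heq
  · filter_upwards [(isOpen_lt continuous_const Complex.continuous_re).mem_nhds
      (show (0 : ℂ) ∈ {s : ℂ | -1 < s.re} by simp), isOpen_ne.mem_nhds zero_ne_one] with s hs hs₁
    simp [riemannZeta_eq_inv_sub_add hs₁, riemannZeta₀_eq_sawtoothMellin hs]

theorem sawtoothMellin_eq_riemannZeta (hs : -1 < s.re) (h₀ : s ≠ 0) (h₁ : s ≠ 1) :
    sawtoothMellin s = riemannZeta s / (s * (s + 1)) + 1 / (2 * s * (1 - s)) := by
  have hadd : s + 1 ≠ 0 := fun h ↦ by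
    simp [eq_neg_of_add_eq_zero_left h] at hs
  have hsub : s - 1 ≠ 0 := sub_ne_zero.2 h₁
  have hsub' : 1 - s ≠ 0 := sub_ne_zero.2 h₁.symm
  rw [riemannZeta_eq_inv_sub_add h₁, riemannZeta₀_eq_sawtoothMellin hs]
  field_simp
  ring

end Mellin

section Unfolding

open Set MeasureTheory

variable {E : Type*} [NormedAddCommGroup E] {f : ℝ → E}

theorem iUnion_Ioc_natCast_add_one : ⋃ r : ℕ, Ioc (r : ℝ) (r + 1) = Ioi 0 := by
  ext y
  simp only [mem_iUnion, mem_Ioc, mem_Ioi]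
  refine ⟨fun ⟨r, hr, _⟩ ↦ r.cast_nonneg.trans_lt hr, fun hy ↦ ⟨⌈y⌉₊ - 1, ?_⟩⟩
  rw [Nat.cast_pred (Nat.ceil_pos.2 hy), sub_add_cancel, sub_lt_iff_lt_add]
  exact ⟨Nat.ceil_lt_add_one hy.le, Nat.le_ceil y⟩

theorem integrableOn_Ioc_comp_add_natCast (hf : IntegrableOn f (Ioi 0)) (r : ℕ) :
    IntegrableOn (fun x ↦ f (x + r)) (Ioc 0 1) := by
  have hr : IntervalIntegrable f volume (0 + r) (1 + r) :=
    (intervalIntegrable_iff_integrableOn_Ioc_of_le (by simp)).2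
      (hf.mono_set fun x hx ↦ (by positivity : (0 : ℝ) ≤ 0 + r).trans_lt hx.1)
  rw [← intervalIntegrable_iff_integrableOn_Ioc_of_le zero_le_one]
  simpa using hr.comp_add_right (c := (r : ℝ))

variable [NormedSpace ℝ E]

theorem hasSum_intervalIntegral_comp_add_natCast (hf : IntegrableOn f (Ioi 0)) :
    HasSum (fun r : ℕ ↦ ∫ x in (0 : ℝ)..1, f (x + r)) (∫ y in Ioi 0, f y) := by
  have hdisj : Pairwise (Function.onFun Disjoint fun r : ℕ ↦ Ioc (r : ℝ) (r + 1)) :=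
    (pairwise_disjoint_Ioc_intCast ℝ).comp_of_injective Nat.cast_injective
  have hsum := hasSum_integral_iUnion (fun _ ↦ measurableSet_Ioc) hdisj
    (iUnion_Ioc_natCast_add_one ▸ hf)
  rw [iUnion_Ioc_natCast_add_one] at hsum
  refine hsum.congr_fun fun r ↦ ?_
  rw [intervalIntegral.integral_comp_add_right, zero_add, add_comm,
    intervalIntegral.integral_of_le (by simp)]

theorem intervalIntegral_tsum_comp_add_natCast (hf : IntegrableOn f (Ioi 0)) :
    ∫ x in (0 : ℝ)..1, ∑' r : ℕ, f (x + r) = ∫ y in Ioi 0, f y := by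
  have hsum := (hasSum_intervalIntegral_comp_add_natCast hf.norm).summable
  rw [← (hasSum_intervalIntegral_comp_add_natCast hf).tsum_eq]
  simp only [intervalIntegral.integral_of_le zero_le_one] at hsum ⊢
  exact (integral_tsum_of_summable_integral_norm (integrableOn_Ioc_comp_add_natCast hf) hsum).symm

end Unfolding

section ChordDeviation

variable {b : ℝ} {c : ℂ}

theorem ofReal_rpow_eq_exp_log_mul (hb : 0 < b) (x : ℝ) :
    ((b ^ x : ℝ) : ℂ) = Complex.exp (Real.log b * x) := by
  rw [Real.rpow_def_of_pos hb]
  push_cast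
  rfl

theorem integral_rpow_mul_exp (hb : 0 < b) (hc : Real.log b + c ≠ 0) (hexp : Complex.exp c = 1) :
    ∫ x in (0 : ℝ)..1, ((b ^ x : ℝ) : ℂ) * Complex.exp (c * x) = (b - 1) / (Real.log b + c) := by
  simp only [ofReal_rpow_eq_exp_log_mul hb, ← Complex.exp_add, ← add_mul]
  rw [integral_exp_mul_complex hc, Complex.ofReal_one, Complex.ofReal_zero, mul_one, mul_zero,
    Complex.exp_zero, Complex.exp_add, hexp, ← Complex.ofReal_exp, Real.exp_log hb, mul_one]

theorem integral_mul_exp (hc : c ≠ 0) (hexp : Complex.exp c = 1) :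
    ∫ x in (0 : ℝ)..1, (x : ℂ) * Complex.exp (c * x) = 1 / c := by
  have hid (x : ℝ) : HasDerivAt (fun x : ℝ ↦ (x : ℂ)) 1 x := Complex.ofRealCLM.hasDerivAt
  have hprim (x : ℝ) : HasDerivAt (fun x : ℝ ↦ Complex.exp (c * x) / c) (Complex.exp (c * x)) x :=
    ((((hid x).const_mul c).cexp).div_const c).congr_deriv (by field_simp)
  rw [intervalIntegral.integral_mul_deriv_eq_deriv_mul (fun x _ ↦ hid x) (fun x _ ↦ hprim x)
    (by simp) (Continuous.intervalIntegrable (by fun_prop) _ _)]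
  simp [intervalIntegral.integral_div, integral_exp_mul_complex hc, hexp]

theorem integral_chord_deviation_mul_exp (hb : 0 < b) (hc : Real.log b + c ≠ 0)
    (hexp : Complex.exp c = 1) :
    ∫ x in (0 : ℝ)..1, (((b ^ x - 1 - (b - 1) * x) / 2 : ℝ) : ℂ) * Complex.exp (c * x) =
      ((b - 1) / (Real.log b + c) - (∫ x in (0 : ℝ)..1, Complex.exp (c * x)) -
        (b - 1) * ∫ x in (0 : ℝ)..1, (x : ℂ) * Complex.exp (c * x)) / 2 := by
  have hpow : Continuous fun x : ℝ ↦ b ^ x := Real.continuous_const_rpow hb.ne'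
  rw [← integral_rpow_mul_exp hb hc hexp, ← intervalIntegral.integral_const_mul,
    ← intervalIntegral.integral_sub, ← intervalIntegral.integral_sub,
    ← intervalIntegral.integral_div]
  · congr 1 with x
    push_cast
    ring
  all_goals exact Continuous.intervalIntegrable (by fun_prop) _ _

end ChordDeviation

section Fourier

open Set MeasureTheory

variable {b : ℝ} {s : ℂ} {k : ℤ}

theorem exp_smul_cpow_mul_sawtoothPrimitive_exp (s : ℂ) (u : ℝ) :
    Real.exp u • ((Real.exp u : ℂ) ^ (-2 - s) * (sawtoothPrimitive (Real.exp u) : ℂ)) =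
      ((sawtoothPrimitive (Real.exp u) / Real.exp u : ℝ) : ℂ) * Complex.exp (-s * u) := by
  have hne : (Real.exp u : ℂ) ≠ 0 := mod_cast (Real.exp_pos u).ne'
  have hcpow : (Real.exp u : ℂ) ^ (-s) = Complex.exp (-s * u) := by
    rw [Complex.cpow_def_of_ne_zero hne, ← Complex.ofReal_log (Real.exp_pos u).le, Real.log_exp,
      mul_comm]
  rw [show -2 - s = -s - (2 : ℕ) by push_cast; ring, Complex.cpow_sub _ _ hne,
    Complex.cpow_natCast, hcpow, Complex.real_smul, Complex.ofReal_div]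
  field_simp

theorem dampedSawtooth_mul_exp_eq (hb : 0 < b) (s : ℂ) (y : ℝ) :
    (dampedSawtooth b y : ℂ) * Complex.exp (-(s * Real.log b) * y) =
      Real.exp (Real.log b * y) • ((Real.exp (Real.log b * y) : ℂ) ^ (-2 - s) *
        (sawtoothPrimitive (Real.exp (Real.log b * y)) : ℂ)) := by
  rw [exp_smul_cpow_mul_sawtoothPrimitive_exp, dampedSawtooth, Real.rpow_def_of_pos hb]
  push_cast
  ring_nf

theorem integrableOn_dampedSawtooth_mul_exp (hb : 1 < b) (hs : -1 < s.re) :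
    IntegrableOn (fun y : ℝ ↦ (dampedSawtooth b y : ℂ) * Complex.exp (-(s * Real.log b) * y))
      (Ioi 0) := by
  simp only [dampedSawtooth_mul_exp_eq (one_pos.trans hb)]
  rw [integrableOn_Ioi_comp_mul_left_iff (fun u ↦ Real.exp u • ((Real.exp u : ℂ) ^ (-2 - s) *
    (sawtoothPrimitive (Real.exp u) : ℂ))) 0 (Real.log_pos hb), mul_zero,
    integrableOn_comp_exp_Ioi fun v ↦ (v : ℂ) ^ (-2 - s) * (sawtoothPrimitive v : ℂ),
    Real.exp_zero]
  exact integrableOn_cpow_mul_sawtoothPrimitive hs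

theorem integral_dampedSawtooth_mul_exp (hb : 1 < b) (s : ℂ) :
    ∫ y in Ioi (0 : ℝ), (dampedSawtooth b y : ℂ) * Complex.exp (-(s * Real.log b) * y) =
      sawtoothMellin s / Real.log b := by
  simp only [dampedSawtooth_mul_exp_eq (one_pos.trans hb)]
  rw [integral_comp_mul_left_Ioi (fun u ↦ Real.exp u • ((Real.exp u : ℂ) ^ (-2 - s) *
    (sawtoothPrimitive (Real.exp u) : ℂ))) 0 (Real.log_pos hb), mul_zero,
    integral_comp_exp_Ioi fun v ↦ (v : ℂ) ^ (-2 - s) * (sawtoothPrimitive v : ℂ), Real.exp_zero,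
    ← sawtoothMellin, Complex.real_smul, Complex.ofReal_inv, inv_mul_eq_div]

theorem re_eq_zero_of_mul_log_eq (hb : 1 < b)
    (hs : s * Real.log b = 2 * Real.pi * Complex.I * k) : s.re = 0 := by
  have h := congrArg Complex.re hs
  rw [Complex.re_mul_ofReal] at h
  simpa [(Real.log_pos hb).ne'] using h

theorem exp_neg_mul_log_eq_one (hs : s * Real.log b = 2 * Real.pi * Complex.I * k) :
    Complex.exp (-(s * Real.log b)) = 1 :=
  Complex.exp_eq_one_iff.2 ⟨-k, by rw [hs]; push_cast; ring⟩

theorem integral_dampedSawtoothSeries_mul_exp (hb : 1 < b)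
    (hs : s * Real.log b = 2 * Real.pi * Complex.I * k) :
    ∫ x in (0 : ℝ)..1, (dampedSawtoothSeries b x : ℂ) * Complex.exp (-(s * Real.log b) * x) =
      sawtoothMellin s / Real.log b := by
  have hre : -1 < s.re := by rw [re_eq_zero_of_mul_log_eq hb hs]; exact neg_one_lt_zero
  have hper (x : ℝ) (r : ℕ) : Complex.exp (-(s * Real.log b) * (x + r : ℝ)) =
      Complex.exp (-(s * Real.log b) * x) := by
    rw [Complex.ofReal_add, mul_add, Complex.exp_add, Complex.ofReal_natCast, mul_comm _ (r : ℂ),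
      Complex.exp_nat_mul, exp_neg_mul_log_eq_one hs, one_pow, mul_one]
  rw [← integral_dampedSawtooth_mul_exp hb,
    ← intervalIntegral_tsum_comp_add_natCast (integrableOn_dampedSawtooth_mul_exp hb hre)]
  simp only [hper, tsum_mul_right, dampedSawtoothSeries, Complex.ofReal_tsum]

theorem fourierCoeffOn_zero_one_eq_integral (f : ℝ → ℂ) (k : ℤ) :
    fourierCoeffOn (zero_lt_one (α := ℝ)) f k =
      ∫ x in (0 : ℝ)..1, f x * Complex.exp (-(2 * Real.pi * Complex.I * k) * x) := by
  rw [fourierCoeffOn_eq_integral, sub_zero, div_one, one_smul]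
  congr 1 with x
  rw [fourier_coe_apply, smul_eq_mul, mul_comm]
  push_cast
  ring_nf

theorem fourierCoeffOn_delangeFluctuation (hb : 1 < b)
    (hs : s * Real.log b = 2 * Real.pi * Complex.I * k) :
    fourierCoeffOn (zero_lt_one (α := ℝ)) (fun x ↦ (delangeFluctuation b x : ℂ)) k =
      (∫ x in (0 : ℝ)..1, (((b ^ x - 1 - (b - 1) * x) / 2 : ℝ) : ℂ) *
        Complex.exp (-(s * Real.log b) * x)) - (b - 1) * (sawtoothMellin s / Real.log b) := by
  have hpow : Continuous fun x : ℝ ↦ b ^ x := Real.continuous_const_rpow (one_pos.trans hb).ne'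
  have hseries := continuous_dampedSawtoothSeries hb
  rw [fourierCoeffOn_zero_one_eq_integral, ← integral_dampedSawtoothSeries_mul_exp hb hs, ← hs,
    ← intervalIntegral.integral_const_mul, ← intervalIntegral.integral_sub]
  · refine intervalIntegral.integral_congr fun x hx ↦ ?_
    rw [uIcc_of_le zero_le_one] at hx
    simp only [delangeFluctuation_eq_delangeProfile hb hx, delangeProfile]
    push_cast
    ring
  all_goals exact Continuous.intervalIntegrable (by fun_prop) _ _

theorem fourierCoeffOn_delangeFluctuation_zero (hb : 1 < b) :
    fourierCoeffOn (zero_lt_one (α := ℝ)) (fun x ↦ (delangeFluctuation b x : ℂ)) 0 =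
      (((b - 1) / (2 * Real.log b) * (Real.log (2 * Real.pi) - 1) - (b + 1) / 4 : ℝ) : ℂ) := by
  have hlog : (Real.log b : ℂ) ≠ 0 := mod_cast (Real.log_pos hb).ne'
  have hid : ∫ x in (0 : ℝ)..1, (x : ℂ) = 1 / 2 := by
    rw [intervalIntegral.integral_ofReal, integral_id]
    norm_num
  rw [fourierCoeffOn_delangeFluctuation (s := 0) hb (by simp), sawtoothMellin_zero, zero_mul,
    neg_zero, integral_chord_deviation_mul_exp (one_pos.trans hb) (by rwa [add_zero])
    Complex.exp_zero]
  simp only [zero_mul, Complex.exp_zero, mul_one, hid, intervalIntegral.integral_const, sub_zero,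
    one_smul, add_zero]
  push_cast
  field_simp
  ring

theorem fourierCoeffOn_delangeFluctuation_of_ne_zero (hb : 1 < b) (hk : k ≠ 0)
    (hs : s * Real.log b = 2 * Real.pi * Complex.I * k) :
    fourierCoeffOn (zero_lt_one (α := ℝ)) (fun x ↦ (delangeFluctuation b x : ℂ)) k =
      -((b - 1) / (s * (1 + s) * Real.log b)) * riemannZeta s := by
  have hlog : (Real.log b : ℂ) ≠ 0 := mod_cast (Real.log_pos hb).ne'
  have hre := re_eq_zero_of_mul_log_eq hb hs
  have hexp := exp_neg_mul_log_eq_one hs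
  have hs₀ : s ≠ 0 := by
    rintro rfl
    simp [hk] at hs
  have hs₁ : s ≠ 1 := by rintro rfl; simp at hre
  have hsub : 1 - s ≠ 0 := sub_ne_zero.2 hs₁.symm
  have hadd : 1 + s ≠ 0 := fun h ↦ by simp [eq_neg_of_add_eq_zero_right h] at hre
  have hneg : -(s * Real.log b) ≠ 0 := neg_ne_zero.2 (mul_ne_zero hs₀ hlog)
  have hfactor : Real.log b + -(s * Real.log b) = (1 - s) * Real.log b := by ring
  rw [fourierCoeffOn_delangeFluctuation hb hs, integral_chord_deviation_mul_exp (one_pos.trans hb)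
    (hfactor ▸ mul_ne_zero hsub hlog) hexp, integral_exp_mul_complex hneg,
    integral_mul_exp hneg hexp, hfactor, sawtoothMellin_eq_riemannZeta (by rw [hre]; norm_num)
    hs₀ hs₁, Complex.ofReal_one, Complex.ofReal_zero, mul_one, mul_zero, Complex.exp_zero, hexp,
    add_comm s 1]
  field_simp
  ring

end Fourier

theorem chi_mul_log {q : ℕ} (hq : 2 ≤ q) (k : ℤ) :
    chi q k * Real.log (q : ℝ) = 2 * Real.pi * Complex.I * k := by
  have hlog : Real.log q ≠ 0 := (Real.log_pos (mod_cast hq)).ne'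
  rw [chi, div_mul_cancel₀ _ (mod_cast hlog)]

theorem corollary1 (q : ℕ) (hq : 2 ≤ q) :
    (∃! Ψ : ℝ → ℝ, IsDigitFluctuation q Ψ) ∧
    ∀ Ψ : ℝ → ℝ, IsDigitFluctuation q Ψ →
      fourierCoeffOn (zero_lt_one (α := ℝ)) (fun x => (Ψ x : ℂ)) 0 =
        ((((q : ℝ) - 1) / (2 * Real.log q) * (Real.log (2 * Real.pi) - 1)
          - ((q : ℝ) + 1) / 4 : ℝ) : ℂ) ∧
      ∀ k : ℤ, k ≠ 0 →
        fourierCoeffOn (zero_lt_one (α := ℝ)) (fun x => (Ψ x : ℂ)) k =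
          -(((q : ℂ) - 1) / (chi q k * (1 + chi q k) * (Real.log q : ℂ)))
            * riemannZeta (chi q k) := by
  have hq₁ : (1 : ℝ) < q := mod_cast hq
  refine ⟨⟨delangeFluctuation q, isDigitFluctuation_delangeFluctuation hq,
    fun Ψ hΨ ↦ hΨ.eq_delangeFluctuation hq⟩, fun Ψ hΨ ↦ ?_⟩
  rw [hΨ.eq_delangeFluctuation hq]
  exact ⟨fourierCoeffOn_delangeFluctuation_zero hq₁, fun k hk ↦ mod_cast
    fourierCoeffOn_delangeFluctuation_of_ne_zero hq₁ hk (chi_mul_log hq k)⟩
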